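/- Let $m\ge 1$ and $n$ be natural numbers, let $G$ be a simple graph with vertices $v_1,\dots,v_m$ and edge set $E(G)$, and suppose that every vertex of $G$ has degree $m-1$ or $m-2$ (that is, each vertex fails to be adjacent to at most one other vertex). For $i=1,\dots,m$ let $X_i\subseteq\mathbb{R}^n$ be a bounded open set and $\mu_i$ a Borel probability measure on $X_i$. Consider the Kantorovich problem of maximizing $$\int_{X_1\times\cdots\times X_m} b\,d\gamma,\qquad b(x_1,\dots,x_m)=\sum_{\{v_i,v_j\}\in E(G)} x_i\cdot x_j,$$ among all Borel probability measures $\gamma$ on $X_1\times\cdots\times X_m$ whose marginals are $\mu_1,\dots,\mu_m$. Assume that $\mu_1$ is absolutely continuous with respect to Lebesgue measure, and that either $v_1$ has degree $m-1$, or $\mu_i$ is absolutely continuous with respect to Lebesgue measure for some $i$ such that $v_i$ is adjacent to $v_1$. Then every solution $\gamma$ of the Kantorovich problem is induced by a map: there are Borel maps $T_i:X_1\to X_i$ $(i=2,\dots,m)$ such that $\gamma=(\mathrm{Id},T_2,\dots,T_m)_\sharp\mu_1$, the image measure of $\mu_1$ under $x\mapsto(x,T_2(x),\dots,T_m(x))$.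 -/

import Mathlib

open MeasureTheory

noncomputable section

/-- The surplus of a graph `G` on the vertices `v_0, …, v_{m-1}`: the sum of `x_i ⬝ x_j` over the
edges `{v_i, v_j}` of `G`; each edge is counted once, through its ordered pair with `i < j`. -/
def graphSurplus {m n : ℕ} (G : SimpleGraph (Fin m)) [DecidableRel G.Adj]
    (x : Fin m → EuclideanSpace ℝ (Fin n)) : ℝ :=
  ∑ p ∈ Finset.univ.filter (fun p : Fin m × Fin m => p.1 < p.2 ∧ G.Adj p.1 p.2),
    inner ℝ (x p.1) (x p.2)

/-- `γ` is a Borel probability measure on the product of the sets `X i` with marginals `μ i`. -/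
def HasMarginals {m n : ℕ} {X : Fin m → Set (EuclideanSpace ℝ (Fin n))}
    (μ : (i : Fin m) → Measure (X i)) (γ : Measure ((i : Fin m) → X i)) : Prop :=
  IsProbabilityMeasure γ ∧ ∀ i, γ.map (fun x => x i) = μ i

/-- `γ` maximizes the integral of the surplus of `G` among all Borel probability measures on the
product of the sets `X i` with marginals `μ i`. -/
def IsKantorovichSolution {m n : ℕ} (G : SimpleGraph (Fin m)) [DecidableRel G.Adj]
    {X : Fin m → Set (EuclideanSpace ℝ (Fin n))}
    (μ : (i : Fin m) → Measure (X i)) (γ : Measure ((i : Fin m) → X i)) : Prop :=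
  HasMarginals μ γ ∧
    ∀ γ' : Measure ((i : Fin m) → X i), HasMarginals μ γ' →
      ∫ x, graphSurplus G (fun i => (x i : EuclideanSpace ℝ (Fin n))) ∂γ' ≤
        ∫ x, graphSurplus G (fun i => (x i : EuclideanSpace ℝ (Fin n))) ∂γ

/-- `γ` is the image of the first marginal under `x ↦ (x, T_1 x, …, T_{m-1} x)`, for some Borel
maps `T_i` from `X 0` to `X i`. -/
def IsInducedByMap {m n : ℕ} [NeZero m] {X : Fin m → Set (EuclideanSpace ℝ (Fin n))}
    (μ : (i : Fin m) → Measure (X i)) (γ : Measure ((i : Fin m) → X i)) : Prop :=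
  ∃ T : (i : Fin m) → X 0 → X i,
    (∀ i, Measurable (T i)) ∧ T 0 = id ∧ γ = (μ 0).map (fun x i => T i x)

/-- Absolute continuity with respect to the Lebesgue measure on `ℝⁿ` of a measure on `A ⊆ ℝⁿ`. -/
def IsAbsCont {n : ℕ} {A : Set (EuclideanSpace ℝ (Fin n))} (ν : Measure A) : Prop :=
  ν.map (Subtype.val : A → EuclideanSpace ℝ (Fin n)) ≪ volume

end

/-! Optimality makes the support `Γ` of a plan cyclically monotone. `Γ` is enlarged to its
`rearrangementHull`, which stays cyclically monotone and is closed under exchanges that leave the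
surplus unchanged (`mem_rearrangementHull_of_swap`).

The surplus is affine in each `x v` with slope `neighborSum G v x`. A Rockafellar potential for the
hull has these slopes as subgradients and is Lipschitz, so by Rademacher almost every value of `x v`
determines `neighborSum G v x` (`exists_ae_neighborSum_eq`).

The degree condition splits the vertices into classes of one or two, with adjacency exactly between
different classes. If two points of the hull have equal total sums, exchanging a whole class gains
the squared distance of their class sums, so these agree. Then exchanging one coordinate `i` is
neutral; when `i` is adjacent to `v` it moves the neighbour sum at `v` by `x' i - x i`, which must
vanish. If `v` has a non-neighbour `k`, a neutral exchange at `k` first equalizes the total sums,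
and the second absolutely continuous marginal determines `x k` (`eq_of_mem_hull`). So the first
coordinate is injective on a set of full measure. -/

/-- Two finite families of points, with multiplicities, have the same marginals. -/
def SameMarginals {ι E : Type*} (s t : Multiset (ι → E)) : Prop :=
  ∀ i, s.map (fun x => x i) = t.map (fun x => x i)

/-- No finite family of points of `Γ` can be rearranged, coordinate by coordinate, so as to
increase the total value of `b`. -/
def MultiCyclicallyMonotone {ι E : Type*} (b : (ι → E) → ℝ) (Γ : Set (ι → E)) : Prop :=
  ∀ s t : Multiset (ι → E), (∀ x ∈ s, x ∈ Γ) → SameMarginals s t →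
    (t.map b).sum ≤ (s.map b).sum

/-- The points which occur in some rearrangement of a finite family of points of `Γ` that leaves
the total value of `b` unchanged. -/
def rearrangementHull {ι E : Type*} (b : (ι → E) → ℝ) (Γ : Set (ι → E)) : Set (ι → E) :=
  {y | ∃ s t : Multiset (ι → E), (∀ x ∈ s, x ∈ Γ) ∧ SameMarginals s t ∧
    (t.map b).sum = (s.map b).sum ∧ y ∈ t}

/-! ### Neutral rearrangements and the hull -/

section Hull

variable {ι E : Type*} {b : (ι → E) → ℝ} {Γ : Set (ι → E)}

theorem subset_rearrangementHull : Γ ⊆ rearrangementHull b Γ := fun x hx =>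
  ⟨{x}, {x}, by simpa using hx, fun _ => rfl, rfl, by simp⟩

theorem exists_coord_eq_of_mem_rearrangementHull {y : ι → E} (hy : y ∈ rearrangementHull b Γ) (i : ι) :
    ∃ x ∈ Γ, x i = y i := by
  obtain ⟨s, t, hs, hst, -, hyt⟩ := hy
  have : y i ∈ s.map (fun x => x i) := by
    rw [hst i]; exact Multiset.mem_map_of_mem _ hyt
  obtain ⟨x, hx, hxy⟩ := Multiset.mem_map.1 this
  exact ⟨x, hs x hx, hxy⟩

/-- Each point of `s` comes from its own neutral rearrangement; these are concatenated, and `r`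
collects the remaining points. -/
theorem exists_completion_of_forall_mem_rearrangementHull (s : Multiset (ι → E))
    (hs : ∀ x ∈ s, x ∈ rearrangementHull b Γ) :
    ∃ S r : Multiset (ι → E), (∀ x ∈ S, x ∈ Γ) ∧ SameMarginals S (s + r) ∧
      ((s + r).map b).sum = (S.map b).sum := by
  induction s using Multiset.induction with
  | empty => exact ⟨0, 0, by simp, fun _ => rfl, rfl⟩
  | cons a s ih =>
    obtain ⟨S, r, hS, hm, hb⟩ := ih fun x hx => hs x (Multiset.mem_cons_of_mem hx)
    obtain ⟨S', t, hS', hm', hb', hat⟩ := hs a (Multiset.mem_cons_self a s)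
    obtain ⟨t', rfl⟩ := Multiset.exists_cons_of_mem hat
    have key : a ::ₘ s + (r + t') = (s + r) + a ::ₘ t' := by
      simp only [← Multiset.singleton_add]; abel
    refine ⟨S + S', r + t', ?_, ?_, ?_⟩
    · intro x hx
      rcases Multiset.mem_add.1 hx with h | h
      exacts [hS x h, hS' x h]
    · intro i
      rw [key, Multiset.map_add, Multiset.map_add, hm i, hm' i]
    · rw [key, Multiset.map_add, Multiset.sum_add, hb, hb', Multiset.map_add, Multiset.sum_add]

/-- Adding the remainder `r` turns a rearrangement of points of the hull into one of points of `Γ`;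
the contribution of `r` cancels. -/
theorem MultiCyclicallyMonotone.rearrangementHull (h : MultiCyclicallyMonotone b Γ) :
    MultiCyclicallyMonotone b (rearrangementHull b Γ) := by
  intro s t hs hst
  obtain ⟨S, r, hS, hm, hb⟩ := exists_completion_of_forall_mem_rearrangementHull s hs
  have := h S (t + r) hS fun i => by
    rw [hm i, Multiset.map_add, Multiset.map_add, hst i]
  rw [← hb, Multiset.map_add, Multiset.map_add, Multiset.sum_add, Multiset.sum_add] at this
  linarith

theorem mem_rearrangementHull_of_swap {x x' y y' : ι → E} (hx : x ∈ rearrangementHull b Γ)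
    (hx' : x' ∈ rearrangementHull b Γ) (hm : SameMarginals {x, x'} {y, y'})
    (hb : b y + b y' = b x + b x') : y ∈ rearrangementHull b Γ := by
  obtain ⟨S, r, hS, hm', hb'⟩ := exists_completion_of_forall_mem_rearrangementHull {x, x'}
    (show ∀ z ∈ ({x, x'} : Multiset (ι → E)), z ∈ rearrangementHull b Γ by simp [hx, hx'])
  refine ⟨S, {y, y'} + r, hS, fun i => ?_, ?_, by simp⟩
  · rw [hm' i, Multiset.map_add, Multiset.map_add, hm i]
  · rw [← hb', Multiset.map_add, Multiset.map_add, Multiset.sum_add, Multiset.sum_add]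
    simp [hb]

theorem sameMarginals_piecewise [DecidableEq ι] (I : Finset ι) (x x' : ι → E) :
    SameMarginals {x, x'} {I.piecewise x' x, I.piecewise x x'} := by
  intro i
  by_cases hi : i ∈ I
  · simpa [hi] using Multiset.pair_comm _ _
  · simp [hi]

end Hull

/-! ### How the surplus changes under exchanges -/

section Surplus

variable {m n : ℕ} {G : SimpleGraph (Fin m)} [DecidableRel G.Adj]

/-- The sum of the points sitting at the neighbours of the vertex `v`. -/
def neighborSum (G : SimpleGraph (Fin m)) [DecidableRel G.Adj] (v : Fin m)
    (x : Fin m → EuclideanSpace ℝ (Fin n)) : EuclideanSpace ℝ (Fin n) :=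
  ∑ j ∈ G.neighborFinset v, x j

theorem neighborSum_congr {v : Fin m} {x y : Fin m → EuclideanSpace ℝ (Fin n)}
    (h : ∀ j, G.Adj v j → x j = y j) : neighborSum G v x = neighborSum G v y :=
  Finset.sum_congr rfl fun j hj => h j ((G.mem_neighborFinset v j).1 hj)

theorem neighborSum_update_of_adj {v i : Fin m} (h : G.Adj v i)
    (x : Fin m → EuclideanSpace ℝ (Fin n)) (z : EuclideanSpace ℝ (Fin n)) :
    neighborSum G v (Function.update x i z) = neighborSum G v x + (z - x i) := by
  have hi : i ∈ G.neighborFinset v := by simpa using h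
  rw [neighborSum, neighborSum, Finset.sum_update_of_mem hi, ← Finset.add_sum_erase _ _ hi,
    Finset.sdiff_singleton_eq_erase]
  abel

theorem neighborSum_add_sum_compl (v : Fin m) (x : Fin m → EuclideanSpace ℝ (Fin n)) :
    neighborSum G v x + ∑ j ∈ (G.neighborFinset v)ᶜ, x j = ∑ j, x j :=
  Finset.sum_add_sum_compl _ _

theorem norm_neighborSum_le (v : Fin m) {x : Fin m → EuclideanSpace ℝ (Fin n)} {R : ℝ}
    (hR : 0 ≤ R) (hx : ∀ j, j ≠ v → ‖x j‖ ≤ R) : ‖neighborSum G v x‖ ≤ m * R := by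
  refine (norm_sum_le _ _).trans ?_
  refine (Finset.sum_le_card_nsmul _ _ R fun j _ => hx j ?_).trans ?_
  · rintro rfl; simp_all
  · rw [nsmul_eq_mul]
    gcongr
    exact (Finset.card_le_univ _).trans (by simp)

theorem graphSurplus_update (v : Fin m) (x : Fin m → EuclideanSpace ℝ (Fin n))
    (z : EuclideanSpace ℝ (Fin n)) :
    graphSurplus G (Function.update x v z) =
      graphSurplus G x + inner ℝ (z - x v) (neighborSum G v x) := by
  have h1 : ∀ i j, (if i < j ∧ G.Adj i j then
        inner ℝ (Function.update x v z i) (Function.update x v z j) else (0 : ℝ)) =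
      (if i < j ∧ G.Adj i j then inner ℝ (x i) (x j) else 0) +
      ((if i = v then (if v < j ∧ G.Adj v j then inner ℝ (z - x v) (x j) else 0) else 0) +
      (if j = v then (if i < v ∧ G.Adj v i then inner ℝ (z - x v) (x i) else 0) else 0)) := by
    intro i j
    by_cases hij : i < j ∧ G.Adj i j
    · have hne := hij.2.ne
      by_cases hi : i = v
      · subst hi
        simp [hij, hne.symm, inner_sub_left]
      · by_cases hj : j = v
        · subst hj
          simp [hij, hi, inner_sub_left, hij.2.symm, real_inner_comm]
        · simp [hij, hi, hj]
    · by_cases hi : i = v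
      · subst hi
        by_cases hj : j = i
        · subst hj; simp
        · simp [hij, hj]
      · by_cases hj : j = v
        · subst hj
          rw [G.adj_comm i j] at hij
          simp [hij, hi, G.adj_comm i j]
        · simp [hij, hi, hj]
  have h2 : inner ℝ (z - x v) (neighborSum G v x) =
      ∑ j, ((if v < j ∧ G.Adj v j then inner ℝ (z - x v) (x j) else (0 : ℝ)) +
        (if j < v ∧ G.Adj v j then inner ℝ (z - x v) (x j) else 0)) := by
    rw [neighborSum, inner_sum, SimpleGraph.neighborFinset_eq_filter, Finset.sum_filter]
    refine Finset.sum_congr rfl fun j _ => ?_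
    by_cases h : G.Adj v j
    · rcases lt_or_gt_of_ne h.ne with h' | h'
      · simp [h, h', h'.not_gt]
      · simp [h, h', h'.not_gt]
    · simp [h]
  unfold graphSurplus
  rw [h2, Finset.sum_filter, Finset.sum_filter, Fintype.sum_prod_type, Fintype.sum_prod_type]
  simp only [h1, Finset.sum_add_distrib]
  congr 2
  · rw [Finset.sum_comm]; simp
  · simp

/-- Changes at pairwise non-adjacent vertices do not interact, so their first-order effects add up
exactly. -/
theorem graphSurplus_piecewise (I : Finset (Fin m)) (hI : ∀ i ∈ I, ∀ j ∈ I, ¬ G.Adj i j)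
    (x x' : Fin m → EuclideanSpace ℝ (Fin n)) :
    graphSurplus G (I.piecewise x' x) =
      graphSurplus G x + ∑ i ∈ I, inner ℝ (x' i - x i) (neighborSum G i x) := by
  induction I using Finset.induction with
  | empty => simp
  | insert j s hj ih =>
    rw [Finset.piecewise_insert, graphSurplus_update, ih fun i hi k hk =>
      hI i (Finset.mem_insert_of_mem hi) k (Finset.mem_insert_of_mem hk),
      Finset.sum_insert hj, Finset.piecewise_eq_of_notMem _ _ _ hj,
      neighborSum_congr (y := x) fun k hk => Finset.piecewise_eq_of_notMem _ _ _ fun hks =>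
        hI j (Finset.mem_insert_self _ _) k (Finset.mem_insert_of_mem hks) hk]
    ring

theorem graphSurplus_swap (I : Finset (Fin m)) (hI : ∀ i ∈ I, ∀ j ∈ I, ¬ G.Adj i j)
    (x x' : Fin m → EuclideanSpace ℝ (Fin n)) :
    graphSurplus G (I.piecewise x' x) + graphSurplus G (I.piecewise x x') =
      graphSurplus G x + graphSurplus G x' -
        ∑ i ∈ I, inner ℝ (x' i - x i) (neighborSum G i x' - neighborSum G i x) := by
  rw [graphSurplus_piecewise I hI, graphSurplus_piecewise I hI]
  have : ∑ i ∈ I, inner ℝ (x' i - x i) (neighborSum G i x' - neighborSum G i x) =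
      - ∑ i ∈ I, inner ℝ (x i - x' i) (neighborSum G i x') -
        ∑ i ∈ I, inner ℝ (x' i - x i) (neighborSum G i x) := by
    rw [← Finset.sum_neg_distrib, ← Finset.sum_sub_distrib]
    refine Finset.sum_congr rfl fun i _ => ?_
    rw [inner_sub_right, ← inner_neg_left, neg_sub]
  rw [this]; ring

theorem continuous_graphSurplus :
    Continuous (graphSurplus G : (Fin m → EuclideanSpace ℝ (Fin n)) → ℝ) := by
  unfold graphSurplus
  fun_prop

end Surplus

/-! ### From optimality to finite rearrangements -/

theorem exists_perm_of_map_univ_eq {κ α : Type*} [Fintype κ] {f g : κ → α}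
    (h : Finset.univ.val.map f = Finset.univ.val.map g) :
    ∃ σ : Equiv.Perm κ, ∀ k, f (σ k) = g k := by
  classical
  have hcard : ∀ a, Fintype.card {k // g k = a} = Fintype.card {k // f k = a} := by
    intro a
    have := congrArg (Multiset.count a) h
    simp only [Multiset.count_map] at this
    rw [Fintype.card_subtype, Fintype.card_subtype, Finset.card_def, Finset.card_def,
      Finset.filter_val, Finset.filter_val]
    simpa only [eq_comm] using this.symm
  let e : ∀ a, {k // g k = a} ≃ {k // f k = a} := fun a => Fintype.equivOfCardEq (hcard a)
  refine ⟨(Equiv.sigmaFiberEquiv g).symm.trans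
    ((Equiv.sigmaCongrRight e).trans (Equiv.sigmaFiberEquiv f)), fun k => ?_⟩
  exact (e (g k) ⟨k, rfl⟩).2

theorem exists_fin_map_univ_eq {α : Type*} {s : Multiset α} {N : ℕ}
    (hs : Multiset.card s = N) : ∃ f : Fin N → α, Finset.univ.val.map f = s := by
  subst hs
  obtain ⟨l, rfl⟩ := Quot.exists_rep s
  exact ⟨l.get, (Fin.univ_val_map _).trans (congrArg _ (List.ofFn_get l))⟩

section Optimal

variable {ι : Type*} [Fintype ι] {Y : ι → Type*} [∀ i, TopologicalSpace (Y i)]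
  [∀ i, SecondCountableTopology (Y i)] [∀ i, MeasurableSpace (Y i)] [∀ i, BorelSpace (Y i)]

/-- Points of the support of an optimal measure cannot be rearranged so as to increase the total
value of the surplus. -/
theorem sum_rearrangement_le_of_mem_support (γ : Measure ((i : ι) → Y i)) [IsProbabilityMeasure γ]
    {c : ((i : ι) → Y i) → ℝ} (hc : Continuous c) {C : ℝ} (hC : ∀ x, ‖c x‖ ≤ C)
    (hopt : ∀ γ' : Measure ((i : ι) → Y i), IsProbabilityMeasure γ' →
      (∀ i, γ'.map (fun x => x i) = γ.map (fun x => x i)) → ∫ x, c x ∂γ' ≤ ∫ x, c x ∂γ)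
    {κ : Type*} [Fintype κ] (w : κ → (i : ι) → Y i) (hw : ∀ k, w k ∈ γ.support)
    (σ : ι → Equiv.Perm κ) :
    ∑ k, c (fun i => w (σ i k) i) ≤ ∑ k, c (w k) := by
  classical
  by_contra! hlt
  have hint : ∀ (ν : Measure ((i : ι) → Y i)) [IsFiniteMeasure ν], Integrable c ν := fun ν _ =>
    Integrable.of_bound hc.aestronglyMeasurable C (Filter.Eventually.of_forall hC)
  set R : κ → (κ → (i : ι) → Y i) → (i : ι) → Y i := fun k v i => v (σ i k) i with hR
  have hRc : ∀ k, Continuous (R k) := fun k => by simp only [hR]; fun_prop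
  have hRm : ∀ k, Measurable (R k) := fun k => by simp only [hR]; fun_prop
  have hem : ∀ k, Measurable fun v : κ → (i : ι) → Y i => v k := fun k => measurable_pi_apply k
  have hcm : Measurable c := hc.measurable
  set F : (κ → (i : ι) → Y i) → ℝ := fun v => ∑ k, c (R k v) - ∑ k, c (v k) with hF
  have hFc : Continuous F := by
    simp only [hF]
    exact (continuous_finsetSum _ fun k _ => hc.comp (hRc k)).sub
      (continuous_finsetSum _ fun k _ => hc.comp (continuous_apply k))
  -- The strict gain at `w` persists on a product of neighbourhoods of positive measure; independent
  -- points drawn from `γ` conditioned on them gain almost surely.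
  obtain ⟨U, hU, hUF⟩ := isOpen_pi_iff'.1 (isOpen_lt continuous_const hFc) w
    (show 0 < F w from sub_pos.2 hlt)
  have hpos : ∀ k, 0 < γ (U k) := fun k =>
    (Measure.mem_support_iff_forall _).1 (hw k) _ ((hU k).1.mem_nhds (hU k).2)
  let γk : κ → Measure ((i : ι) → Y i) := fun k => ProbabilityTheory.cond γ (U k)
  have : ∀ k, IsProbabilityMeasure (γk k) := fun k =>
    ProbabilityTheory.cond_isProbabilityMeasure (hpos k).ne'
  set P : Measure (κ → (i : ι) → Y i) := Measure.pi γk with hP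
  have hPe : ∀ k, P.map (fun v => v k) = γk k := fun k => (measurePreserving_eval γk k).map_eq
  set ν₀ : Measure ((i : ι) → Y i) := ∑ k, P.map (fun v => v k) with hν₀
  set ν₁ : Measure ((i : ι) → Y i) := ∑ k, P.map (R k) with hν₁
  have hp0 : ∀ k, IsProbabilityMeasure (P.map (fun v => v k)) := fun k =>
    Measure.isProbabilityMeasure_map (hem k).aemeasurable
  have hp1 : ∀ k, IsProbabilityMeasure (P.map (R k)) := fun k =>
    Measure.isProbabilityMeasure_map (hRm k).aemeasurable
  -- `P` is concentrated on a set where `F > 0`.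
  have hPF : ∀ᵐ v ∂P, 0 < F v := by
    have : ∀ᵐ v ∂P, ∀ k, v k ∈ U k := by
      refine ae_all_iff.2 fun k => ?_
      have h1 : ∀ᵐ x ∂(P.map (fun v => v k)), x ∈ U k := by
        rw [hPe]
        exact ProbabilityTheory.ae_cond_mem (hU k).1.measurableSet
      exact ae_of_ae_map (hem k).aemeasurable h1
    filter_upwards [this] with v hv
    exact hUF fun k _ => hv k
  have hintP : ∀ f : (κ → (i : ι) → Y i) → (i : ι) → Y i, Measurable f →
      Integrable (fun v => c (f v)) P := fun f hf =>
    Integrable.of_bound (hcm.comp hf).aestronglyMeasurable C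
      (Filter.Eventually.of_forall fun v => hC _)
  have hFi : Integrable F P :=
    (integrable_finsetSum _ fun k _ => hintP _ (hRm k)).sub
      (integrable_finsetSum _ fun k _ => hintP _ (hem k))
  have hI0 : ∫ x, c x ∂ν₀ = ∫ v, ∑ k, c (v k) ∂P := by
    rw [hν₀, integral_finsetSum_measure fun k _ => hint _,
      integral_finsetSum _ fun k _ => hintP _ (hem k)]
    exact Finset.sum_congr rfl fun k _ =>
      integral_map (hem k).aemeasurable hc.aestronglyMeasurable
  have hI1 : ∫ x, c x ∂ν₁ = ∫ v, ∑ k, c (R k v) ∂P := by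
    rw [hν₁, integral_finsetSum_measure fun k _ => hint _,
      integral_finsetSum _ fun k _ => hintP _ (hRm k)]
    exact Finset.sum_congr rfl fun k _ =>
      integral_map (hRm k).aemeasurable hc.aestronglyMeasurable
  have hlt' : ∫ x, c x ∂ν₀ < ∫ x, c x ∂ν₁ := by
    rw [hI0, hI1, ← sub_pos, ← integral_sub
      (integrable_finsetSum _ fun k _ => hintP _ (hRm k))
      (integrable_finsetSum _ fun k _ => hintP _ (hem k))]
    refine (integral_pos_iff_support_of_nonneg_ae (hPF.mono fun v hv => hv.le) hFi).2 ?_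
    rw [pos_iff_ne_zero]
    intro h0
    have : ∀ᵐ v ∂P, False := by
      filter_upwards [hPF, measure_eq_zero_iff_ae_notMem.1 h0] with v hv hv'
      exact hv' hv.ne'
    exact IsProbabilityMeasure.ne_zero P (by simpa using this)
  have hmarg : ∀ i, ν₀.map (fun x => x i) = ν₁.map (fun x => x i) := by
    intro i
    have hi : Measurable fun x : (i : ι) → Y i => x i := measurable_pi_apply i
    -- Coordinate `i` of `R k v` is that of `v (σ i k)`, so reindexing by `σ i` matches the two
    -- sums.
    rw [hν₀, hν₁, Measure.map_finset_sum hi.aemeasurable, Measure.map_finset_sum hi.aemeasurable,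
      ← Equiv.sum_comp (σ i)]
    refine Finset.sum_congr rfl fun k _ => ?_
    rw [Measure.map_map hi (hem _), Measure.map_map hi (hRm _)]
    rfl
  -- a small multiple of `ν₀` lies below `γ`
  obtain ⟨η, hη0, hηle⟩ : ∃ η : NNReal, 0 < η ∧ η • ν₀ ≤ γ := by
    have hle : ν₀ ≤ (∑ k, (γ (U k))⁻¹) • γ := by
      rw [hν₀, Finset.sum_smul]
      refine Finset.sum_le_sum fun k _ => ?_
      rw [hPe]
      exact Measure.le_iff'.2 fun s => by
        simp only [γk, ProbabilityTheory.cond, Measure.smul_apply, smul_eq_mul]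
        gcongr
        exact Measure.restrict_le_self
    have hfin : ∑ k, (γ (U k))⁻¹ ≠ ⊤ := by
      simpa [ENNReal.sum_eq_top] using fun k => (hpos k).ne'
    lift ∑ k, (γ (U k))⁻¹ to NNReal using hfin with D hD
    refine ⟨(D + 1)⁻¹, by positivity, ?_⟩
    calc (D + 1)⁻¹ • ν₀ ≤ (D + 1)⁻¹ • ((D + 1) • γ) := by
          refine Measure.le_iff'.2 fun s => ?_
          have h1 : ν₀ s ≤ D * γ s := by simpa using Measure.le_iff'.1 hle s
          have h2 : (D : ENNReal) ≤ ((D + 1 : NNReal) : ENNReal) := by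
            exact_mod_cast le_self_add
          simp only [Measure.smul_apply, ENNReal.smul_def, smul_eq_mul]
          gcongr
          exact h1.trans (by gcongr)
      _ = γ := by rw [smul_smul, inv_mul_cancel₀ (by positivity), one_smul]
  have : IsFiniteMeasure ν₀ := by rw [hν₀]; infer_instance
  have : IsFiniteMeasure ν₁ := by rw [hν₁]; infer_instance
  have hsub := Measure.sub_add_cancel_of_le hηle
  -- The competitor replaces the part `η • ν₀` of `γ` by `η • ν₁`: same marginals, strictly larger
  -- integral.
  set ρ := γ - η • ν₀ with hρ
  have hmarg' : ∀ i, (ρ + η • ν₁).map (fun x => x i) = γ.map (fun x => x i) := by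
    intro i
    have hi : Measurable fun x : (i : ι) → Y i => x i := measurable_pi_apply i
    conv_rhs => rw [← hsub]
    rw [Measure.map_add _ _ hi, Measure.map_add _ _ hi, Measure.map_smul, Measure.map_smul,
      hmarg i]
  have hprob : IsProbabilityMeasure (ρ + η • ν₁) := by
    have h1 : ν₁ Set.univ = ν₀ Set.univ := by
      simp [hν₀, hν₁]
    constructor
    rw [← measure_univ (μ := γ), ← hsub]
    simp [h1]
  have := hopt _ hprob hmarg'
  conv_rhs at this => rw [← hsub]
  rw [integral_add_measure (hint _) (hint _), integral_add_measure (hint _) (hint _),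
    integral_smul_nnreal_measure, integral_smul_nnreal_measure] at this
  have h3 := smul_lt_smul_of_pos_left hlt' hη0
  linarith

end Optimal

/-! ### Rockafellar potentials and Rademacher's theorem -/

section Potential

variable {m n : ℕ} {G : SimpleGraph (Fin m)} [DecidableRel G.Adj]

/-- Subtracting a supporting linear function leaves a minimum at `a`, so its slope is the gradient
of `φ`. -/
theorem eq_of_forall_affine_le {E : Type*} [NormedAddCommGroup E] [InnerProductSpace ℝ E]
    {φ : E → ℝ} {a p q : E} (hφ : DifferentiableAt ℝ φ a)
    (hp : ∀ z, φ a + inner ℝ (z - a) p ≤ φ z) (hq : ∀ z, φ a + inner ℝ (z - a) q ≤ φ z) :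
    p = q := by
  have key : ∀ r : E, (∀ z, φ a + inner ℝ (z - a) r ≤ φ z) → fderiv ℝ φ a = innerSL ℝ r := by
    intro r hr
    have hmin : IsLocalMin (fun z => φ z - innerSL ℝ r z) a := by
      refine Filter.Eventually.of_forall fun z => ?_
      have := hr z
      rw [inner_sub_left, real_inner_comm, real_inner_comm r a] at this
      simp only [innerSL_apply_apply]
      linarith
    have h0 := hmin.fderiv_eq_zero
    rw [fderiv_fun_sub hφ (innerSL ℝ r).differentiableAt, ContinuousLinearMap.fderiv] at h0
    exact sub_eq_zero.1 h0
  exact (innerSL_inj (𝕜 := ℝ)).1 ((key p hp).symm.trans (key q hq))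

/-- The total gains that finite rearrangements of points of `Γ` can achieve when, at the vertex
`v`, one of the points is exchanged from `a` to `z`. -/
def rearrangementGains (G : SimpleGraph (Fin m)) [DecidableRel G.Adj]
    (Γ : Set (Fin m → EuclideanSpace ℝ (Fin n))) (v : Fin m) (a z : EuclideanSpace ℝ (Fin n)) :
    Set ℝ :=
  {r | ∃ s t : Multiset (Fin m → EuclideanSpace ℝ (Fin n)), (∀ x ∈ s, x ∈ Γ) ∧
    (∀ i, i ≠ v → s.map (fun x => x i) = t.map (fun x => x i)) ∧
    z ::ₘ s.map (fun x => x v) = a ::ₘ t.map (fun x => x v) ∧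
    r = (t.map (graphSurplus G)).sum - (s.map (graphSurplus G)).sum}

variable {Γ : Set (Fin m → EuclideanSpace ℝ (Fin n))}

theorem add_mem_rearrangementGains {v : Fin m} {a z : EuclideanSpace ℝ (Fin n)} {r : ℝ}
    {x : Fin m → EuclideanSpace ℝ (Fin n)} (hx : x ∈ Γ)
    (hr : r ∈ rearrangementGains G Γ v a (x v)) :
    r + inner ℝ (z - x v) (neighborSum G v x) ∈ rearrangementGains G Γ v a z := by
  obtain ⟨s, t, hs, hst, hv, rfl⟩ := hr
  refine ⟨x ::ₘ s, Function.update x v z ::ₘ t, ?_, ?_, ?_, ?_⟩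
  · intro y hy
    rcases Multiset.mem_cons.1 hy with rfl | hy
    exacts [hx, hs y hy]
  · intro i hi
    simp [hi, hst i hi]
  · rw [Multiset.map_cons, hv, Multiset.map_cons, Function.update_self, Multiset.cons_swap]
  · rw [Multiset.map_cons, Multiset.map_cons, Multiset.sum_cons, Multiset.sum_cons,
      graphSurplus_update]
    ring

/-- Either `z` is the base value, where gains are at most zero and the chain is restarted from `x₀`,
or `z` occurs in `t` and is replaced there by `z'`. The slope omits coordinate `v`, hence is at most
`m * R` even though `z` is unbounded. -/
theorem exists_le_add_of_mem_rearrangementGains (hΓ : MultiCyclicallyMonotone (graphSurplus G) Γ)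
    {R : ℝ} (hR : 0 ≤ R) (hb : ∀ x ∈ Γ, ∀ i, ‖x i‖ ≤ R) {x₀ : Fin m → EuclideanSpace ℝ (Fin n)}
    (hx₀ : x₀ ∈ Γ) {v : Fin m} {z : EuclideanSpace ℝ (Fin n)} {r : ℝ}
    (hr : r ∈ rearrangementGains G Γ v (x₀ v) z) (z' : EuclideanSpace ℝ (Fin n)) :
    ∃ r' ∈ rearrangementGains G Γ v (x₀ v) z', r ≤ r' + m * R * ‖z - z'‖ := by
  have habs : ∀ p : EuclideanSpace ℝ (Fin n), ‖p‖ ≤ m * R →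
      0 ≤ inner ℝ (z' - z) p + m * R * ‖z - z'‖ := by
    intro p hp
    have h1 := (abs_le.1 (abs_real_inner_le_norm (z' - z) p)).1
    have h2 : ‖z' - z‖ * ‖p‖ ≤ ‖z - z'‖ * (m * R) := by rw [norm_sub_rev]; gcongr
    linarith
  obtain ⟨s, t, hs, hst, hv, rfl⟩ := hr
  have hmem : z ∈ x₀ v ::ₘ t.map (fun x => x v) := hv ▸ Multiset.mem_cons_self _ _
  rcases Multiset.mem_cons.1 hmem with rfl | hmem
  · have hle := hΓ s t hs fun i => by
      by_cases hi : i = v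
      · subst hi; exact (Multiset.cons_inj_right _).1 hv
      · exact hst i hi
    refine ⟨_, add_mem_rearrangementGains (r := 0) (z := z') hx₀
      ⟨0, 0, by simp, fun _ _ => rfl, rfl, by simp⟩, ?_⟩
    have := habs _ (norm_neighborSum_le (G := G) v hR fun j _ => hb x₀ hx₀ j)
    linarith
  · obtain ⟨τ, hτ, rfl⟩ := Multiset.mem_map.1 hmem
    have hτR : ∀ j, j ≠ v → ‖τ j‖ ≤ R := by
      intro j hj
      have : τ j ∈ s.map (fun x => x j) := by
        rw [hst j hj]; exact Multiset.mem_map_of_mem _ hτ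
      obtain ⟨x, hx, hxj⟩ := Multiset.mem_map.1 this
      exact hxj ▸ hb x (hs x hx) j
    obtain ⟨t', rfl⟩ := Multiset.exists_cons_of_mem hτ
    refine ⟨_, ⟨s, Function.update τ v z' ::ₘ t', hs, ?_, ?_, rfl⟩, ?_⟩
    · intro i hi
      rw [hst i hi]
      simp [hi]
    · rw [Multiset.map_cons, Multiset.cons_swap] at hv
      rw [Multiset.map_cons, Multiset.cons_swap, Function.update_self,
        (Multiset.cons_inj_right _).1 hv]
    · simp only [Multiset.map_cons, Multiset.sum_cons, graphSurplus_update]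
      have := habs _ (norm_neighborSum_le (G := G) v hR hτR)
      linarith

/-- The potential is the supremum of the gains from a fixed base point; appending a point of `Γ` to
a rearrangement gives the subgradient inequality. -/
theorem exists_lipschitz_potential (hΓ : MultiCyclicallyMonotone (graphSurplus G) Γ)
    {R : ℝ} (hR : 0 ≤ R) (hb : ∀ x ∈ Γ, ∀ i, ‖x i‖ ≤ R) (v : Fin m) :
    ∃ (φ : EuclideanSpace ℝ (Fin n) → ℝ) (C : NNReal), LipschitzWith C φ ∧
      ∀ x ∈ Γ, ∀ z, φ (x v) + inner ℝ (z - x v) (neighborSum G v x) ≤ φ z := by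
  rcases Γ.eq_empty_or_nonempty with rfl | ⟨x₀, hx₀⟩
  · exact ⟨fun _ => 0, 0, LipschitzWith.const _, by simp⟩
  set W := rearrangementGains G Γ v (x₀ v) with hW
  have hmove := fun {z : EuclideanSpace ℝ (Fin n)} {r : ℝ} (hr : r ∈ W z) =>
    exists_le_add_of_mem_rearrangementGains hΓ hR hb hx₀ hr
  have hbase : ∀ r ∈ W (x₀ v), r ≤ 0 := by
    rintro r ⟨s, t, hs, hst, hv, rfl⟩
    have := hΓ s t hs fun i => by
      by_cases hi : i = v
      · subst hi; exact (Multiset.cons_inj_right _).1 hv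
      · exact hst i hi
    linarith
  have h0 : (0 : ℝ) ∈ W (x₀ v) := ⟨0, 0, by simp, fun _ _ => rfl, rfl, by simp⟩
  have hne : ∀ z, (W z).Nonempty := fun z => ⟨_, add_mem_rearrangementGains hx₀ h0⟩
  have hbdd : ∀ z, BddAbove (W z) := fun z => ⟨m * R * ‖z - x₀ v‖, fun r hr => by
    obtain ⟨r', hr', hle⟩ := hmove hr (x₀ v)
    linarith [hbase r' hr']⟩
  refine ⟨fun z => sSup (W z), (m * R).toNNReal, LipschitzWith.of_le_add_mul' _ ?_, ?_⟩
  · intro z z'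
    refine csSup_le (hne z) fun r hr => ?_
    obtain ⟨r', hr', hle⟩ := hmove hr z'
    rw [dist_eq_norm]
    linarith [le_csSup (hbdd z') hr']
  · intro x hx z
    rw [← le_sub_iff_add_le]
    refine csSup_le (hne _) fun r hr => ?_
    linarith [le_csSup (hbdd z) (add_mem_rearrangementGains (z := z) hx hr)]

theorem exists_ae_neighborSum_eq (hΓ : MultiCyclicallyMonotone (graphSurplus G) Γ)
    {R : ℝ} (hR : 0 ≤ R) (hb : ∀ x ∈ Γ, ∀ i, ‖x i‖ ≤ R) (v : Fin m) :
    ∀ᵐ a : EuclideanSpace ℝ (Fin n), ∀ x ∈ Γ, ∀ y ∈ Γ, x v = a → y v = a →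
      neighborSum G v x = neighborSum G v y := by
  obtain ⟨φ, C, hφ, hsub⟩ := exists_lipschitz_potential hΓ hR hb v
  filter_upwards [hφ.ae_differentiableAt] with a ha x hx y hy hxa hya
  exact eq_of_forall_affine_le ha (hxa ▸ hsub x hx) (hya ▸ hsub y hy)

end Potential

/-! ### One coordinate determines a point of the hull -/

section Uniqueness

variable {m n : ℕ} {G : SimpleGraph (Fin m)} [DecidableRel G.Adj]
  {Γ : Set (Fin m → EuclideanSpace ℝ (Fin n))}

theorem self_mem_compl_neighborFinset (i : Fin m) : i ∈ (G.neighborFinset i)ᶜ := by simp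

theorem card_compl_neighborFinset_le (hG : ∀ v, G.degree v + 1 = m ∨ G.degree v + 2 = m)
    (i : Fin m) : (G.neighborFinset i)ᶜ.card ≤ 2 := by
  rw [Finset.card_compl, Fintype.card_fin, G.card_neighborFinset_eq_degree]
  rcases hG i with h | h <;> omega

/-- Both sets contain `i` and `j` and have at most two elements, so for `i ≠ j` both are the pair.
-/
theorem compl_neighborFinset_eq_of_mem (hG : ∀ v, G.degree v + 1 = m ∨ G.degree v + 2 = m)
    {i j : Fin m} (hj : j ∈ (G.neighborFinset i)ᶜ) :
    (G.neighborFinset j)ᶜ = (G.neighborFinset i)ᶜ := by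
  by_cases hij : j = i
  · rw [hij]
  have hi : i ∈ (G.neighborFinset j)ᶜ := by
    simpa [G.adj_comm] using hj
  have hpair : ∀ k : Fin m, i ∈ (G.neighborFinset k)ᶜ → j ∈ (G.neighborFinset k)ᶜ →
      {i, j} = (G.neighborFinset k)ᶜ := by
    intro k h1 h2
    refine Finset.eq_of_subset_of_card_le (by simp [Finset.insert_subset_iff, *]) ?_
    rw [Finset.card_pair (Ne.symm hij)]
    exact card_compl_neighborFinset_le hG k
  rw [← hpair i (self_mem_compl_neighborFinset i) hj,
    ← hpair j hi (self_mem_compl_neighborFinset j)]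

theorem eq_or_eq_of_not_adj (hG : ∀ v, G.degree v + 1 = m ∨ G.degree v + 2 = m)
    {i j k : Fin m} (hij : ¬ G.Adj i j) (hne : i ≠ j) (hik : ¬ G.Adj i k) : k = i ∨ k = j := by
  have : {i, j} = (G.neighborFinset i)ᶜ := by
    refine Finset.eq_of_subset_of_card_le (by simp [Finset.insert_subset_iff, *]) ?_
    rw [Finset.card_pair hne]
    exact card_compl_neighborFinset_le hG i
  have hk : k ∈ ({i, j} : Finset (Fin m)) := by rw [this]; simpa using hik
  simpa using hk

/-- Exchanging a coordinate which sees the same neighbours in two points of the hull. -/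
theorem update_mem_hull {x x' : Fin m → EuclideanSpace ℝ (Fin n)}
    (hx : x ∈ rearrangementHull (graphSurplus G) Γ)
    (hx' : x' ∈ rearrangementHull (graphSurplus G) Γ) {i : Fin m}
    (h : neighborSum G i x = neighborSum G i x') :
    Function.update x i (x' i) ∈ rearrangementHull (graphSurplus G) Γ := by
  rw [← Finset.piecewise_singleton]
  refine mem_rearrangementHull_of_swap hx hx' (sameMarginals_piecewise {i} x x') ?_
  rw [graphSurplus_swap {i} (by simp)]
  simp [h]

/-- Two points of the hull with the same sum agree in sum on each class of pairwise non-adjacent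
vertices. -/
theorem sum_compl_neighborFinset_eq (hΓ : MultiCyclicallyMonotone (graphSurplus G) Γ)
    (hG : ∀ v, G.degree v + 1 = m ∨ G.degree v + 2 = m)
    {x x' : Fin m → EuclideanSpace ℝ (Fin n)} (hx : x ∈ Γ) (hx' : x' ∈ Γ)
    (hS : ∑ j, x j = ∑ j, x' j) (i : Fin m) :
    ∑ j ∈ (G.neighborFinset i)ᶜ, x j = ∑ j ∈ (G.neighborFinset i)ᶜ, x' j := by
  set I := (G.neighborFinset i)ᶜ with hI
  have hind : ∀ j ∈ I, ∀ k ∈ I, ¬ G.Adj j k := by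
    intro j hj k hk
    rw [hI, ← compl_neighborFinset_eq_of_mem hG hj] at hk
    simpa using hk
  have hle := hΓ {x, x'} _ (by simp [hx, hx']) (sameMarginals_piecewise I x x')
  simp only [Multiset.insert_eq_cons, Multiset.map_cons, Multiset.map_singleton,
    Multiset.sum_cons, Multiset.sum_singleton] at hle
  rw [graphSurplus_swap I hind] at hle
  -- The neighbours of `j` are exactly the vertices outside `I`, so its neighbour sum is the total
  -- minus the class sum. The swap thus gains a squared norm, which monotonicity forces to be zero.
  have hterm : ∀ j ∈ I, neighborSum G j x' - neighborSum G j x =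
      -(∑ k ∈ I, x' k - ∑ k ∈ I, x k) := by
    intro j hj
    have h1 := neighborSum_add_sum_compl (G := G) j x
    have h2 := neighborSum_add_sum_compl (G := G) j x'
    rw [compl_neighborFinset_eq_of_mem hG hj] at h1 h2
    rw [eq_sub_of_add_eq h1, eq_sub_of_add_eq h2, hS]
    abel
  rw [Finset.sum_congr rfl fun j hj => by rw [hterm j hj], ← sum_inner, Finset.sum_sub_distrib,
    inner_neg_right, real_inner_self_eq_norm_sq] at hle
  have : ‖∑ k ∈ I, x' k - ∑ k ∈ I, x k‖ = 0 := by
    have := norm_nonneg (∑ k ∈ I, x' k - ∑ k ∈ I, x k)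
    nlinarith
  exact (sub_eq_zero.1 (norm_eq_zero.1 this)).symm

theorem eq_of_adj_of_sum_eq (hΓ : MultiCyclicallyMonotone (graphSurplus G) Γ)
    (hG : ∀ v, G.degree v + 1 = m ∨ G.degree v + 2 = m) {v : Fin m}
    {a : EuclideanSpace ℝ (Fin n)}
    (ha : ∀ x ∈ rearrangementHull (graphSurplus G) Γ,
      ∀ y ∈ rearrangementHull (graphSurplus G) Γ, x v = a → y v = a →
      neighborSum G v x = neighborSum G v y)
    {x x' : Fin m → EuclideanSpace ℝ (Fin n)}
    (hx : x ∈ rearrangementHull (graphSurplus G) Γ)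
    (hx' : x' ∈ rearrangementHull (graphSurplus G) Γ)
    (hxa : x v = a) (hS : ∑ j, x j = ∑ j, x' j) {i : Fin m} (hi : G.Adj v i) :
    x i = x' i := by
  have hsum := sum_compl_neighborFinset_eq hΓ.rearrangementHull hG hx hx' hS i
  have hN : neighborSum G i x = neighborSum G i x' := by
    rw [eq_sub_of_add_eq (neighborSum_add_sum_compl (G := G) i x),
      eq_sub_of_add_eq (neighborSum_add_sum_compl (G := G) i x'), hS, hsum]
  have := ha _ (update_mem_hull hx hx' hN) x hx
    (by rw [Function.update_of_ne hi.ne, hxa]) hxa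
  rw [neighborSum_update_of_adj hi, add_eq_left] at this
  exact (sub_eq_zero.1 this).symm

/-- A point of the hull is determined by its coordinate at `v`. -/
theorem eq_of_mem_hull (hΓ : MultiCyclicallyMonotone (graphSurplus G) Γ)
    (hG : ∀ v, G.degree v + 1 = m ∨ G.degree v + 2 = m) {v : Fin m}
    {x x' : Fin m → EuclideanSpace ℝ (Fin n)}
    (hx : x ∈ rearrangementHull (graphSurplus G) Γ)
    (hx' : x' ∈ rearrangementHull (graphSurplus G) Γ) (hxx' : x v = x' v)
    (hv : ∀ y ∈ rearrangementHull (graphSurplus G) Γ,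
      ∀ z ∈ rearrangementHull (graphSurplus G) Γ, y v = x v → z v = x v →
      neighborSum G v y = neighborSum G v z)
    (h : G.degree v + 1 = m ∨ ∃ i, G.Adj v i ∧ ∀ y ∈ rearrangementHull (graphSurplus G) Γ,
      ∀ z ∈ rearrangementHull (graphSurplus G) Γ, y i = x i → z i = x i →
      neighborSum G i y = neighborSum G i z) : x = x' := by
  have hN := hv x hx x' hx' rfl hxx'.symm
  by_cases hall : ∃ k, k ≠ v ∧ ¬ G.Adj v k
  · obtain ⟨k, hkv, hk⟩ := hall
    have hrest : ∀ j, j = v ∨ j = k ∨ G.Adj v j := by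
      intro j
      by_cases hj : G.Adj v j
      · exact Or.inr (Or.inr hj)
      · rcases eq_or_eq_of_not_adj hG hk hkv.symm hj with h | h
        exacts [Or.inl h, Or.inr (Or.inl h)]
    have hIv : (G.neighborFinset v)ᶜ = {v, k} := by
      ext j
      rcases hrest j with rfl | rfl | h
      · simp
      · simp [hk]
      · simp [h, h.ne', show j ≠ k by rintro rfl; exact hk h]
    have hIk : (G.neighborFinset k)ᶜ = {v, k} := by
      rw [compl_neighborFinset_eq_of_mem hG (i := v) (by simpa using hk), hIv]
    have hNk : ∀ y : Fin m → EuclideanSpace ℝ (Fin n), neighborSum G k y = neighborSum G v y := by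
      intro y
      rw [eq_sub_of_add_eq (neighborSum_add_sum_compl (G := G) k y),
        eq_sub_of_add_eq (neighborSum_add_sum_compl (G := G) v y), hIv, hIk]
    -- `v` and `k` have the same neighbours, so the exchange at `k` is neutral; afterwards `y` and
    -- `x'` agree at both `v` and `k`, hence in total sum.
    set y := Function.update x k (x' k) with hy
    have hymem : y ∈ rearrangementHull (graphSurplus G) Γ :=
      update_mem_hull hx hx' (by rw [hNk, hNk, hN])
    have hyv : y v = x v := Function.update_of_ne hkv.symm _ _
    have hS : ∑ j, y j = ∑ j, x' j := by
      rw [← neighborSum_add_sum_compl (G := G) v y, ← neighborSum_add_sum_compl (G := G) v x',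
        hv y hymem x' hx' hyv hxx'.symm, hIv, Finset.sum_pair hkv.symm, Finset.sum_pair hkv.symm,
        hyv, hxx', hy, Function.update_self]
    have hyx' : ∀ j, G.Adj v j → y j = x' j := fun j hj =>
      eq_of_adj_of_sum_eq hΓ hG hv hymem hx' hyv hS hj
    have hne : ∀ j, j ≠ k → x j = x' j := by
      intro j hj
      rcases hrest j with rfl | rfl | h
      · exact hxx'
      · exact absurd rfl hj
      · rw [← hyx' j h, hy, Function.update_of_ne hj]
    have hkk : x k = x' k := by
      -- Full degree is excluded by `k`. Otherwise `i` is also adjacent to `k`, and `y` and `x`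
      -- differ at most at `k`, so equality of their neighbour sums at `i` gives the claim.
      rcases h with h | ⟨i, hvi, hi⟩
      · have := congrArg Finset.card hIv
        rw [Finset.card_compl, Fintype.card_fin, G.card_neighborFinset_eq_degree,
          Finset.card_pair hkv.symm] at this
        omega
      · have hik : i ≠ k := by rintro rfl; exact hk hvi
        have hadj : G.Adj i k := by
          by_contra hcon
          have : i ∈ (G.neighborFinset k)ᶜ := by simpa [G.adj_comm] using hcon
          rw [hIk] at this
          simp [hik, hvi.ne'] at this
        have := hi y hymem x hx (Function.update_of_ne hik _ _) rfl
        rw [hy, neighborSum_update_of_adj hadj, add_eq_left] at this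
        exact (sub_eq_zero.1 this).symm
    funext j
    by_cases hj : j = k
    · rw [hj, hkk]
    · exact hne j hj
  · push Not at hall
    have hIv : (G.neighborFinset v)ᶜ = {v} := by
      ext j
      by_cases hj : j = v
      · simp [hj]
      · simp [hj, hall j hj]
    have hS : ∑ j, x j = ∑ j, x' j := by
      rw [← neighborSum_add_sum_compl (G := G) v x, ← neighborSum_add_sum_compl (G := G) v x',
        hN, hIv, Finset.sum_singleton, Finset.sum_singleton, hxx']
    funext j
    by_cases hj : j = v
    · rw [hj, hxx']
    · exact eq_of_adj_of_sum_eq hΓ hG hv hx hx' rfl hS (hall j hj)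

end Uniqueness

/-! ### Cyclic monotonicity of the support -/

section Support

variable {m n : ℕ} {G : SimpleGraph (Fin m)} [DecidableRel G.Adj]
  {X : Fin m → Set (EuclideanSpace ℝ (Fin n))}

theorem exists_norm_graphSurplus_le (hXb : ∀ i, Bornology.IsBounded (X i)) :
    ∃ C, ∀ x : (i : Fin m) → X i,
      ‖graphSurplus G (fun i => (x i : EuclideanSpace ℝ (Fin n)))‖ ≤ C := by
  have hb : Bornology.IsBounded (Set.univ.pi X) := Bornology.IsBounded.pi hXb
  obtain ⟨C, hC⟩ := (hb.isCompact_closure.image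
    (continuous_graphSurplus (G := G))).isBounded.exists_norm_le
  exact ⟨C, fun x => hC _ (Set.mem_image_of_mem _ (subset_closure fun i _ => (x i).2))⟩

/-- The support of an optimal plan is cyclically monotone. -/
theorem IsKantorovichSolution.multiCyclicallyMonotone [NeZero m]
    (hXb : ∀ i, Bornology.IsBounded (X i))
    {μ : (i : Fin m) → Measure (X i)} {γ : Measure ((i : Fin m) → X i)}
    (hγ : IsKantorovichSolution G μ γ) :
    MultiCyclicallyMonotone (graphSurplus G)
      ((fun x i => (x i : EuclideanSpace ℝ (Fin n))) '' γ.support) := by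
  intro s t hs hst
  -- Equal marginals fix the cardinality only through some coordinate, hence the need for a vertex.
  have hcard : Multiset.card t = Multiset.card s := by
    simpa using (congrArg Multiset.card (hst 0)).symm
  obtain ⟨f, hf⟩ := exists_fin_map_univ_eq (s := s) rfl
  obtain ⟨g, hg⟩ := exists_fin_map_univ_eq hcard
  have hσ : ∀ i, ∃ σ : Equiv.Perm (Fin (Multiset.card s)), ∀ k, f (σ k) i = g k i := fun i =>
    exists_perm_of_map_univ_eq (f := fun k => f k i) (g := fun k => g k i) <| by
      have := hst i
      rw [← hf, ← hg, Multiset.map_map, Multiset.map_map] at this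
      exact this
  choose σ hσ using hσ
  have hw : ∀ k, ∃ w ∈ γ.support, (fun i => (w i : EuclideanSpace ℝ (Fin n))) = f k := fun k =>
    hs (f k) (by rw [← hf]; exact Multiset.mem_map_of_mem _ (Finset.mem_univ_val k))
  choose w hw hwf using hw
  have := hγ.1.1
  obtain ⟨C, hC⟩ := exists_norm_graphSurplus_le (G := G) hXb
  have key := sum_rearrangement_le_of_mem_support γ
    (c := fun x => graphSurplus G fun i => (x i : EuclideanSpace ℝ (Fin n)))
    (continuous_graphSurplus.comp (by fun_prop)) hC
    (fun γ' h1 h2 => hγ.2 γ' ⟨h1, fun i => (h2 i).trans (hγ.1.2 i)⟩) w hw σ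
  have hgw : ∀ k, (fun i => (w (σ i k) i : EuclideanSpace ℝ (Fin n))) = g k := fun k =>
    funext fun i => by rw [← hσ i k, ← hwf]
  simp only [hgw, hwf] at key
  rw [← hf, ← hg, Multiset.map_map, Multiset.map_map]
  exact key

end Support

/-! ### From injectivity to a Borel map -/

/-- By Lusin–Souslin, an injective Borel map on a standard Borel space is a measurable embedding;
its inverse, extended measurably, supplies the maps. -/
theorem isInducedByMap_of_injOn {m n : ℕ} [NeZero m] {X : Fin m → Set (EuclideanSpace ℝ (Fin n))}
    (hX : ∀ i, MeasurableSet (X i)) {μ : (i : Fin m) → Measure (X i)}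
    {γ : Measure ((i : Fin m) → X i)} (hγ : HasMarginals μ γ) {K : Set ((i : Fin m) → X i)}
    (hK : ∀ᵐ x ∂γ, x ∈ K) (hinj : Set.InjOn (fun x => x 0) K) : IsInducedByMap μ γ := by
  have := hγ.1
  have := fun i => (hX i).standardBorel
  -- `K` need not be measurable, so it is shrunk to a Borel subset of full measure.
  obtain ⟨L, hLK, hLm, hL⟩ : ∃ L ⊆ K, MeasurableSet L ∧ ∀ᵐ x ∂γ, x ∈ L := by
    refine ⟨(toMeasurable γ Kᶜ)ᶜ, ?_, (measurableSet_toMeasurable _ _).compl, ?_⟩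
    · exact Set.compl_subset_comm.1 (subset_toMeasurable _ _)
    · rw [ae_iff]
      exact measure_mono_null (fun x hx => not_not.1 hx)
        ((measure_toMeasurable _).trans (ae_iff.1 hK))
  have := hLm.standardBorel
  have h0 : Measurable fun x : (i : Fin m) → X i => x 0 := measurable_pi_apply 0
  have hemb : MeasurableEmbedding fun x : L => x.1 0 :=
    (h0.comp measurable_subtype_coe).measurableEmbedding fun x y hxy =>
      Subtype.ext (hinj (hLK x.2) (hLK y.2) hxy)
  obtain ⟨x₀⟩ : Nonempty ((i : Fin m) → X i) := nonempty_of_isProbabilityMeasure γ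
  obtain ⟨T, hT, hTL⟩ := hemb.exists_measurable_extend measurable_subtype_coe fun _ => ⟨x₀⟩
  have hTx : ∀ x ∈ L, T (x 0) = x := fun x hx => congrFun hTL ⟨x, hx⟩
  set S : (i : Fin m) → X 0 → X i := Function.update (fun i a => T a i) 0 id with hS
  have hSm : ∀ i, Measurable (S i) := by
    intro i
    by_cases hi : i = 0
    · subst hi
      rw [hS, Function.update_self]
      exact measurable_id
    · rw [hS, Function.update_of_ne hi]
      exact (measurable_pi_apply i).comp hT
  refine ⟨S, hSm, Function.update_self _ _ _, ?_⟩
  rw [← hγ.2 0, Measure.map_map (measurable_pi_lambda _ hSm) h0]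
  conv_lhs => rw [← Measure.map_id (μ := γ)]
  refine Measure.map_congr ?_
  filter_upwards [hL] with x hx
  funext i
  by_cases hi : i = 0
  · subst hi
    simp
  · simp [hi, hTx x hx]

theorem HasMarginals.ae_of_ae_volume {m n : ℕ} {X : Fin m → Set (EuclideanSpace ℝ (Fin n))}
    {μ : (i : Fin m) → Measure (X i)} {γ : Measure ((i : Fin m) → X i)} (hγ : HasMarginals μ γ)
    {i : Fin m} (hi : IsAbsCont (μ i)) {p : EuclideanSpace ℝ (Fin n) → Prop}
    (hp : ∀ᵐ a, p a) : ∀ᵐ x ∂γ, p (x i) := by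
  have h1 : ∀ᵐ a ∂(μ i), p a.1 := ae_of_ae_map measurable_subtype_coe.aemeasurable (Measure.AbsolutelyContinuous.ae_le hi hp)
  rw [← hγ.2 i] at h1
  exact ae_of_ae_map (measurable_pi_apply i).aemeasurable h1

theorem corollary3p2 (m n : ℕ) [NeZero m] (G : SimpleGraph (Fin m)) [DecidableRel G.Adj]
    (hG : ∀ v, G.degree v + 1 = m ∨ G.degree v + 2 = m)
    (X : Fin m → Set (EuclideanSpace ℝ (Fin n)))
    (hXo : ∀ i, IsOpen (X i)) (hXb : ∀ i, Bornology.IsBounded (X i))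
    (μ : (i : Fin m) → Measure (X i)) (hμ : ∀ i, IsProbabilityMeasure (μ i))
    (hμ0 : IsAbsCont (μ 0))
    (h : G.degree 0 + 1 = m ∨ ∃ i, G.Adj 0 i ∧ IsAbsCont (μ i))
    (γ : Measure ((i : Fin m) → X i)) (hγ : IsKantorovichSolution G μ γ) :
    IsInducedByMap μ γ := by
  have := hγ.1.1
  set Γ : Set (Fin m → EuclideanSpace ℝ (Fin n)) :=
    (fun x i => (x i : EuclideanSpace ℝ (Fin n))) '' γ.support with hΓ
  have hmono : MultiCyclicallyMonotone (graphSurplus G) Γ := hγ.multiCyclicallyMonotone hXb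
  have hb : Bornology.IsBounded (⋃ i, X i) := (Bornology.isBounded_iUnion).2 hXb
  obtain ⟨R, hR, hRX⟩ := hb.exists_pos_norm_le
  have hbH : ∀ x ∈ rearrangementHull (graphSurplus G) Γ, ∀ i, ‖x i‖ ≤ R := by
    intro y hy i
    obtain ⟨_, ⟨x, -, rfl⟩, hxy⟩ := exists_coord_eq_of_mem_rearrangementHull hy i
    rw [← hxy]
    exact hRX _ (Set.mem_iUnion.2 ⟨i, (x i).2⟩)
  -- The exceptional null set must serve the whole hull, since the uniqueness argument exchanges
  -- coordinates and leaves the support.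
  have hgood := fun v => exists_ae_neighborSum_eq hmono.rearrangementHull hR.le hbH v
  have hsupp : ∀ᵐ x ∂γ, x ∈ γ.support := Measure.support_mem_ae
  have h0 := hγ.1.ae_of_ae_volume hμ0 (hgood 0)
  have hmem : ∀ x ∈ γ.support, (fun i => (x i : EuclideanSpace ℝ (Fin n))) ∈
      rearrangementHull (graphSurplus G) Γ := fun x hx =>
    subset_rearrangementHull (Set.mem_image_of_mem _ hx)
  have hext : ∀ x x' : (i : Fin m) → X i, (fun i => (x i : EuclideanSpace ℝ (Fin n))) =
      (fun i => (x' i : EuclideanSpace ℝ (Fin n))) → x = x' := fun x x' hxx' =>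
    funext fun i => Subtype.ext (congrFun hxx' i)
  rcases h with hdeg | ⟨i, hi, hμi⟩
  · refine isInducedByMap_of_injOn (fun i => (hXo i).measurableSet) hγ.1 (hsupp.and h0) ?_
    intro x hx x' hx' hxx'
    exact hext _ _ (eq_of_mem_hull hmono hG (hmem x hx.1) (hmem x' hx'.1)
      (congrArg Subtype.val hxx') hx.2 (Or.inl hdeg))
  · refine isInducedByMap_of_injOn (fun i => (hXo i).measurableSet) hγ.1
      (hsupp.and (h0.and (hγ.1.ae_of_ae_volume hμi (hgood i)))) ?_
    intro x hx x' hx' hxx'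
    exact hext _ _ (eq_of_mem_hull hmono hG (hmem x hx.1) (hmem x' hx'.1)
      (congrArg Subtype.val hxx') hx.2.1 (Or.inr ⟨i, hi, hx.2.2⟩))
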